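/- For $d\ge 0$, let the $d$th moment variety of a two-parameter family of distributions with moments $m_0(\theta)=1,m_1(\theta),m_2(\theta),\dots$ that are polynomials in the parameters $\theta\in\mathbb{C}^2$ be the Zariski closure $\mathcal{M}_d\subseteq\mathbb{P}^d_{\mathbb{C}}$ of the set of points $[m_0(\theta):m_1(\theta):\cdots:m_d(\theta)]$, $\theta\in\mathbb{C}^2$. Consider the moment varieties of the following families. - Inverse Gaussian, $\mathcal{M}_d^{\mathrm{IG}}$, with mean $\mu$, shape $\lambda$ and parameters $\theta=(\mu,\nu)$, $\nu=1/\lambda$: $m_0=1$, $m_1=\mu$, $m_i=(2i-3)\nu\mu^2m_{i-1}+\mu^2m_{i-2}$ for $i\ge 2$. - Gamma, $\mathcal{M}_d^{\Gamma}$, with shape $k$ and scale $\vartheta$: $m_i=\vartheta^i\prod_{j=0}^{i-1}(k+j)$. - Gaussian, $\mathcal{M}_d^{\mathrm{Gaussian}}$, with mean $\mu$ and variance $s=\sigma^2$: $m_0=1$, $m_1=\mu$, $m_i=\mu m_{i-1}+(i-1)s\,m_{i-2}$ for $i\ge 2$ (so $m_2=\mu^2+s$, $m_3=\mu^3+3\mu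 s$). For such a variety, let $X=\mathcal{M}_d\cap\{m_0=1\}\subseteq\mathbb{C}^d$. The Euclidean distance degree $\operatorname{EDdegree}(\mathcal{M}_d)$ is the number of complex critical points, on the regular locus of $X$, of the function $x\mapsto\sum_{i=1}^d(x_i-u_i)^2$ for generic $u\in\mathbb{C}^d$, that is, for all $u$ outside the zero set of some nonzero polynomial; here a regular point $x\in X$ is critical if the differential of this function at $x$ vanishes on the tangent space $T_xX$. Then $$\operatorname{EDdegree}(\mathcal{M}_3^{\mathrm{IG}})=12,\qquad \operatorname{EDdegree}(\mathcal{M}_3^{\Gamma})=10,\qquad \operatorname{EDdegree}(\mathcal{M}_3^{\mathrm{Gaussian}})=7 .$$ -/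

import Mathlib

open scoped LinearAlgebra.Projectivization

noncomputable section

namespace MomentVariety

/-! ### Projective varieties -/

/-- The Zariski closure of a set `S` of points of `ℙⁿ(ℂ)`: the points at which every homogeneous
polynomial vanishing on `S` vanishes. -/
def projZariskiClosure {n : ℕ} (S : Set (ℙ ℂ (Fin (n + 1) → ℂ))) :
    Set (ℙ ℂ (Fin (n + 1) → ℂ)) :=
  {p | ∀ (F : MvPolynomial (Fin (n + 1)) ℂ) (k : ℕ), F.IsHomogeneous k →
    (∀ q ∈ S, MvPolynomial.eval q.rep F = 0) → MvPolynomial.eval p.rep F = 0}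

theorem cons_one_ne_zero {n : ℕ} (x : Fin n → ℂ) :
    (Fin.cons 1 x : Fin (n + 1) → ℂ) ≠ 0 := fun h => by
  simpa using congrFun h 0

/-- The affine patch `{m₀ = 1}` of a subset of `ℙⁿ(ℂ)`, as a subset of `ℂⁿ`. -/
def affinePatch {n : ℕ} (V : Set (ℙ ℂ (Fin (n + 1) → ℂ))) : Set (Fin n → ℂ) :=
  {x | Projectivization.mk ℂ (Fin.cons 1 x) (cons_one_ne_zero x) ∈ V}

/-! ### Moment varieties -/

/-- The `d`-th moment variety of a family with parameters `θ : Θ` and moments `m θ 0, m θ 1, …`: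
the Zariski closure in `ℙᵈ(ℂ)` of the set of all points `[m θ 0 : m θ 1 : ⋯ : m θ d]`. -/
def momentVariety {Θ : Type} (m : Θ → ℕ → ℂ) (d : ℕ) : Set (ℙ ℂ (Fin (d + 1) → ℂ)) :=
  projZariskiClosure
    {p | ∃ (θ : Θ) (h : (fun i : Fin (d + 1) => m θ i) ≠ 0), p = Projectivization.mk ℂ _ h}

/-- The moments of the inverse Gaussian distribution with mean `μ` and shape parameter `lam`, as
polynomials in `μ` and `ν = 1 / lam`:
`m₀ = 1`, `m₁ = μ`, `mᵢ = (2 i - 3) / lam * μ² * mᵢ₋₁ + μ² * mᵢ₋₂` for `i ≥ 2`. -/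
def inverseGaussianMoment (μ ν : ℂ) : ℕ → ℂ
  | 0 => 1
  | 1 => μ
  | i + 2 => (2 * ((i : ℂ) + 2) - 3) * ν * μ ^ 2 * inverseGaussianMoment μ ν (i + 1)
      + μ ^ 2 * inverseGaussianMoment μ ν i

/-- The moments `mᵢ = θⁱ k (k + 1) ⋯ (k + i - 1)` of the gamma distribution with shape `k` and
scale `θ`. -/
def gammaMoment (k θ : ℂ) (i : ℕ) : ℂ := θ ^ i * ∏ j ∈ Finset.range i, (k + j)

/-- The moments of the Gaussian distribution with mean `μ` and variance `s = σ²`: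
`m₀ = 1`, `m₁ = μ`, `mᵢ = μ mᵢ₋₁ + (i - 1) s mᵢ₋₂` for `i ≥ 2`, so that `m₂ = μ² + s` and
`m₃ = μ³ + 3 μ s`. -/
def gaussianMoment (μ s : ℂ) : ℕ → ℂ
  | 0 => 1
  | 1 => μ
  | i + 2 => μ * gaussianMoment μ s (i + 1) + ((i : ℂ) + 1) * s * gaussianMoment μ s i

/-- The `d`-th inverse Gaussian moment variety; the parameters are `(μ, 1 / lam)`. -/
def inverseGaussianVariety (d : ℕ) : Set (ℙ ℂ (Fin (d + 1) → ℂ)) :=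
  momentVariety (fun θ : ℂ × ℂ => inverseGaussianMoment θ.1 θ.2) d

/-- The `d`-th gamma moment variety; the parameters are `(k, θ)`. -/
def gammaVariety (d : ℕ) : Set (ℙ ℂ (Fin (d + 1) → ℂ)) :=
  momentVariety (fun θ : ℂ × ℂ => gammaMoment θ.1 θ.2) d

/-- The `d`-th Gaussian moment variety; the parameters are `(μ, σ²)`. -/
def gaussianVariety (d : ℕ) : Set (ℙ ℂ (Fin (d + 1) → ℂ)) :=
  momentVariety (fun θ : ℂ × ℂ => gaussianMoment θ.1 θ.2) d

/-! ### The Euclidean distance degree of an irreducible affine variety -/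

/-- The ideal of all polynomials vanishing on `X ⊆ ℂⁿ`. -/
abbrev idealOf {n : ℕ} (X : Set (Fin n → ℂ)) : Ideal (MvPolynomial (Fin n) ℂ) :=
  MvPolynomial.vanishingIdeal ℂ X

/-- The Zariski tangent space of `X` at `x`: the vectors annihilated by the differentials at `x` of
all polynomials vanishing on `X`. -/
def tangentSpace {n : ℕ} (X : Set (Fin n → ℂ)) (x : Fin n → ℂ) : Submodule ℂ (Fin n → ℂ) where
  carrier := {v | ∀ f ∈ idealOf X, ∑ i, MvPolynomial.eval x (MvPolynomial.pderiv i f) * v i = 0}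
  zero_mem' := fun f _ => by simp
  add_mem' := fun {a b} ha hb f hf => by
    simp only [Pi.add_apply, mul_add, Finset.sum_add_distrib, ha f hf, hb f hf, add_zero]
  smul_mem' := fun c v hv f hf => by
    have h := congrArg (fun t => c * t) (hv f hf)
    simpa only [Pi.smul_apply, smul_eq_mul, Finset.mul_sum, mul_left_comm, mul_zero] using h

/-- `x ∈ X` is a regular point of the irreducible affine variety `X`: the tangent space at `x` has
the dimension of `X`, i.e. the Krull dimension of the coordinate ring of `X`. -/
def IsRegularPoint {n : ℕ} (X : Set (Fin n → ℂ)) (x : Fin n → ℂ) : Prop :=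
  x ∈ X ∧ ((Module.finrank ℂ (tangentSpace X x) : ℕ) : WithBot ℕ∞) =
    ringKrullDim (MvPolynomial (Fin n) ℂ ⧸ idealOf X)

/-- The (complex) critical points on the regular locus of `X` of the squared distance function
`x ↦ ∑ i, (x i - u i) ^ 2` to the data point `u`: its differential vanishes on the tangent space. -/
def criticalPoints {n : ℕ} (X : Set (Fin n → ℂ)) (u : Fin n → ℂ) : Set (Fin n → ℂ) :=
  {x | IsRegularPoint X x ∧ ∀ v ∈ tangentSpace X x, ∑ i, 2 * (x i - u i) * v i = 0}

/-- `X` has Euclidean distance degree `N`: for generic data `u ∈ ℂⁿ`, i.e. for all `u` outside the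
zero set of some nonzero polynomial, the squared distance to `u` has exactly `N` critical points
on `X`. -/
def HasEDDegree {n : ℕ} (X : Set (Fin n → ℂ)) (N : ℕ) : Prop :=
  ∃ g : MvPolynomial (Fin n) ℂ, g ≠ 0 ∧
    ∀ u : Fin n → ℂ, MvPolynomial.eval u g ≠ 0 → (criticalPoints X u).encard = N

end MomentVariety

end

/-! Each affine patch is an explicit surface in `ℂ³` with coordinates `x, y, z`: the graph `z = 3xy
- 2x³` for the Gaussian, and `xz = αy² + βx²y + γx⁴` with `(α, β, γ) = (3, -3, 1)` for the inverse
Gaussian and `(2, -1, 0)` for the gamma family. The equations come from homogeneous relations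
between the moments; conversely, the moments fill a dense part of a polynomial parametrization
(`eval_mem_affinePatch`).

Being critical means that `v - u` is orthogonal to two tangent vectors, which gives two polynomial
equations in two unknowns: `(x, y)` on the graph, `(x, s)` with `y = sx` on the quartic surfaces.
The line `x = y = 0` of the latter carries no critical point when `u 1 ≠ 0`, because `(0, 1, 0)` is
tangent there (`quartic_tangent_line`).

Repeated pseudo-division of these equations produces a one-variable eliminant `R`, of degree 12, 10
or 7 for generic `u`, and a linear equation for the other unknown. Critical points then correspond
to the roots of `R` as long as these are simple and avoid the zeros of the divisors used. This is an
open condition on `u`, expressed by a resultant (`exists_generic_roots`), so it is enough to check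
it at the single data point `(0, 1, 0)`. -/

noncomputable section
namespace MomentVariety
open MvPolynomial

/-! ### The affine patch of a moment variety -/

/-- The moment vector of a family with `m₀ = 1` is `(1, m₁, …, m_d)`. -/
theorem moments_eq_cons {d : ℕ} {m : ℕ → ℂ} (hm : m 0 = 1) :
    (fun i : Fin (d + 1) => m i) = Fin.cons 1 (fun i : Fin d => m (i + 1)) := by
  funext i
  refine Fin.cases ?_ (fun j => ?_) i <;> simp [hm]

theorem IsHomogeneous.eval_smul {n k : ℕ} {F : MvPolynomial (Fin n) ℂ} (hF : F.IsHomogeneous k)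
    (a : ℂ) (v : Fin n → ℂ) : eval (a • v) F = a ^ k * eval v F := by
  rw [eval_eq', eval_eq', Finset.mul_sum]
  refine Finset.sum_congr rfl fun d hd => ?_
  have hk : ∑ i, d i = k := by
    rw [← hF (mem_support_iff.mp hd), Finsupp.weight_apply, Finsupp.sum_fintype _ _ (by simp)]
    simp
  simp only [Pi.smul_apply, smul_eq_mul, mul_pow, Finset.prod_mul_distrib,
    Finset.prod_pow_eq_pow_sum, hk]
  ring

theorem eval_rep_mk_eq_zero_iff {n k : ℕ} {F : MvPolynomial (Fin n) ℂ} (hF : F.IsHomogeneous k)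
    {v : Fin n → ℂ} (hv : v ≠ 0) :
    eval (Projectivization.mk ℂ v hv).rep F = 0 ↔ eval v F = 0 := by
  obtain ⟨a, ha⟩ := Projectivization.exists_smul_eq_mk_rep ℂ v hv
  rw [← ha, Units.smul_def, IsHomogeneous.eval_smul hF]
  simp

/-- Setting the first coordinate to 1 turns a homogeneous `F` that vanishes on the moments into an
affine `G` that does, so affine closure points are projective ones. -/
theorem mem_affinePatch_of_forall {d : ℕ} {Θ : Type} {m : Θ → ℕ → ℂ} (hm : ∀ θ, m θ 0 = 1)
    {v : Fin d → ℂ}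
    (hv : ∀ G : MvPolynomial (Fin d) ℂ,
      (∀ θ, eval (fun i : Fin d => m θ (i + 1)) G = 0) → eval v G = 0) :
    v ∈ affinePatch (momentVariety m d) := by
  have key : ∀ (F : MvPolynomial (Fin (d + 1)) ℂ) (w : Fin d → ℂ),
      eval w (aeval (Fin.cons 1 X : Fin (d + 1) → MvPolynomial (Fin d) ℂ) F)
        = eval (Fin.cons 1 w) F := by
    intro F w
    rw [← coe_aeval_eq_eval, RingHom.coe_coe, comp_aeval_apply, ← coe_aeval_eq_eval,
      RingHom.coe_coe]
    congr 2
    funext i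
    refine Fin.cases ?_ (fun j => ?_) i <;> simp
  intro F k hF hS
  rw [eval_rep_mk_eq_zero_iff hF, ← key]
  refine hv _ fun θ => ?_
  have hne : (fun i : Fin (d + 1) => m θ i) ≠ 0 := by
    rw [moments_eq_cons (hm θ)]
    exact cons_one_ne_zero _
  rw [key, ← moments_eq_cons (hm θ), ← eval_rep_mk_eq_zero_iff hF hne]
  exact hS _ ⟨θ, hne, rfl⟩

theorem eval_eq_zero_of_mem_affinePatch {d k : ℕ} {Θ : Type} {m : Θ → ℕ → ℂ}
    (hm : ∀ θ, m θ 0 = 1) {v : Fin d → ℂ} (hv : v ∈ affinePatch (momentVariety m d))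
    {F : MvPolynomial (Fin (d + 1)) ℂ} (hF : F.IsHomogeneous k)
    (h : ∀ θ, eval (Fin.cons 1 fun i : Fin d => m θ (i + 1)) F = 0) :
    eval (Fin.cons 1 v) F = 0 := by
  rw [← eval_rep_mk_eq_zero_iff hF (cons_one_ne_zero v)]
  refine hv F k hF ?_
  rintro _ ⟨θ, h0, rfl⟩
  rw [eval_rep_mk_eq_zero_iff hF, moments_eq_cons (hm θ)]
  exact h θ

/-- A density argument: if `G` vanishes on all moments, then `G ∘ P` vanishes wherever `D ≠ 0`, so
`D * (G ∘ P) = 0` in an integral domain and `G ∘ P = 0`. Hence the moments need to realize `P` only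
off the curve `D = 0`. -/
theorem eval_mem_affinePatch {d : ℕ} {Θ : Type} {m : Θ → ℕ → ℂ} (hm : ∀ θ, m θ 0 = 1)
    (P : Fin d → MvPolynomial (Fin 2) ℂ) {D : MvPolynomial (Fin 2) ℂ} (hD : D ≠ 0)
    (h : ∀ p, eval p D ≠ 0 → ∃ θ, ∀ i : Fin d, m θ (i + 1) = eval p (P i)) (p : Fin 2 → ℂ) :
    (fun i => eval p (P i)) ∈ affinePatch (momentVariety m d) := by
  refine mem_affinePatch_of_forall hm fun G hG => ?_
  have key : ∀ q : Fin 2 → ℂ, eval q (aeval P G) = eval (fun i => eval q (P i)) G := by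
    intro q
    rw [← coe_aeval_eq_eval, RingHom.coe_coe, comp_aeval_apply, ← coe_aeval_eq_eval,
      RingHom.coe_coe]
  have h0 : D * aeval P G = 0 := by
    refine MvPolynomial.funext fun q => ?_
    rw [map_mul, map_zero, mul_eq_zero, or_iff_not_imp_left]
    intro hq
    obtain ⟨θ, hθ⟩ := h q hq
    rw [key, ← funext hθ]
    exact hG θ
  rw [← key, (mul_eq_zero.mp h0).resolve_left hD, map_zero]

/-! ### Tangent vectors -/

theorem derivative_aeval_eq_sum {n : ℕ} (γ : Fin n → Polynomial ℂ) (f : MvPolynomial (Fin n) ℂ) :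
    Polynomial.derivative (aeval γ f)
      = ∑ i, aeval γ (pderiv i f) * Polynomial.derivative (γ i) := by
  induction f using MvPolynomial.induction_on with
  | C a => simp
  | add p q hp hq => simp only [map_add, hp, hq, add_mul, Finset.sum_add_distrib]
  | mul_X p j hp =>
    have hj : ∑ i, aeval γ (p * pderiv i (X j)) * Polynomial.derivative (γ i)
        = aeval γ p * Polynomial.derivative (γ j) := by
      rw [Finset.sum_eq_single j (fun i _ hij => by simp [pderiv_X_of_ne hij.symm]) (by simp)]
      simp
    rw [map_mul, aeval_X, Polynomial.derivative_mul, hp, ← hj, Finset.sum_mul, add_comm,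
      ← Finset.sum_add_distrib]
    refine Finset.sum_congr rfl fun i _ => ?_
    rw [Derivation.leibniz, map_add, smul_eq_mul, smul_eq_mul, map_mul _ (X j), aeval_X]
    ring

theorem eval_aeval_curve {n : ℕ} (γ : Fin n → Polynomial ℂ) (f : MvPolynomial (Fin n) ℂ) (e : ℂ) :
    (aeval γ f).eval e = eval (fun i => (γ i).eval e) f := by
  rw [← Polynomial.coe_aeval_eq_eval, ← coe_aeval_eq_eval, RingHom.coe_coe,
    comp_aeval_apply]

/-- The velocity of a polynomial curve in `X` is a tangent vector. -/
theorem velocity_mem_tangentSpace {n : ℕ} {X : Set (Fin n → ℂ)} (γ : Fin n → Polynomial ℂ)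
    (hγ : ∀ e : ℂ, (fun i => (γ i).eval e) ∈ X) (e : ℂ) {x v : Fin n → ℂ}
    (hx : ∀ i, (γ i).eval e = x i) (hv : ∀ i, (Polynomial.derivative (γ i)).eval e = v i) :
    v ∈ tangentSpace X x := by
  intro f hf
  have h0 : aeval γ f = 0 := by
    refine Polynomial.funext fun t => ?_
    rw [eval_aeval_curve, Polynomial.eval_zero]
    have := mem_vanishingIdeal_iff.mp hf _ (hγ t)
    rwa [← coe_aeval_eq_eval]
  have h1 := congrArg (Polynomial.eval e) (derivative_aeval_eq_sum γ f)
  rw [h0, Polynomial.derivative_zero, Polynomial.eval_zero, Polynomial.eval_finsetSum] at h1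
  rw [h1]
  refine Finset.sum_congr rfl fun i _ => ?_
  rw [Polynomial.eval_mul, eval_aeval_curve, hv, funext hx]

/-- A subspace of `ℂ³` that is the tangent plane of a graph over the first two coordinates. -/
theorem tangent_plane {T : Submodule ℂ (Fin 3 → ℂ)} {p q r : ℂ} (h1 : ![1, p, q] ∈ T)
    (h2 : ![0, 1, r] ∈ T) (hT : ∀ v ∈ T, v 2 = q * v 0 + r * (v 1 - p * v 0)) :
    Module.finrank ℂ T = 2 ∧ ∀ d : Fin 3 → ℂ, (∀ v ∈ T, ∑ i, 2 * d i * v i = 0) ↔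
      d 0 + p * d 1 + q * d 2 = 0 ∧ d 1 + r * d 2 = 0 := by
  -- The equation `hT` bounds `T` from above; together with the two given vectors it makes them a
  -- basis.
  have hspan : ∀ v ∈ T, v = v 0 • ![1, p, q] + (v 1 - p * v 0) • ![0, 1, r] := by
    intro v hv
    funext i
    fin_cases i
    · simp
    · simp; ring
    · simp [hT v hv]; ring
  constructor
  · have hli : LinearIndependent ℂ ![(![1, p, q] : Fin 3 → ℂ), ![0, 1, r]] := by
      rw [LinearIndependent.pair_iff]
      intro s t h
      have e0 := congrFun h 0
      have e1 := congrFun h 1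
      simp at e0 e1
      subst e0
      simpa using e1
    have hTe : T = Submodule.span ℂ (Set.range ![(![1, p, q] : Fin 3 → ℂ), ![0, 1, r]]) := by
      refine le_antisymm (fun v hv => ?_) (Submodule.span_le.mpr ?_)
      · rw [hspan v hv]
        exact add_mem (Submodule.smul_mem _ _ (Submodule.subset_span ⟨0, rfl⟩))
          (Submodule.smul_mem _ _ (Submodule.subset_span ⟨1, rfl⟩))
      · rintro _ ⟨i, rfl⟩
        fin_cases i
        exacts [h1, h2]
    rw [hTe, finrank_span_eq_card hli, Fintype.card_fin]
  · intro d
    constructor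
    · intro h
      have e1 := h _ h1
      have e2 := h _ h2
      simp [Fin.sum_univ_three] at e1 e2
      constructor
      · linear_combination e1 / 2
      · linear_combination e2 / 2
    · rintro ⟨e1, e2⟩ v hv
      rw [Fin.sum_univ_three, hT v hv]
      linear_combination 2 * v 0 * e1 + 2 * (v 1 - p * v 0) * e2

/-! ### Dimension -/

theorem isIntegral_of_forall_X {R : Type*} [CommRing R] {n : ℕ}
    (φ : R →+* MvPolynomial (Fin n) ℂ) (hC : ∀ a, φ.IsIntegralElem (C a))
    (hX : ∀ j, φ.IsIntegralElem (X j)) : φ.IsIntegral := by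
  intro p
  induction p using MvPolynomial.induction_on with
  | C a => exact hC a
  | add p q hp hq => exact hp.add φ hq
  | mul_X p j hp => exact hp.mul φ (hX j)

/-- Incomparability: strict chains of primes of `B` contract to strict chains in `A`. Injectivity of
`f` plays no role in this direction. -/
theorem ringKrullDim_le_of_isIntegral {A B : Type*} [CommRing A] [CommRing B] (f : A →+* B)
    (hf : f.IsIntegral) : ringKrullDim B ≤ ringKrullDim A := by
  let _ := f.toAlgebra
  have : Algebra.IsIntegral A B := ⟨hf⟩
  refine Order.krullDim_le_of_strictMono (PrimeSpectrum.comap f) fun I J hIJ => ?_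
  exact Ideal.IsIntegral.comap_lt_comap (R := A) (A := B) hIJ

/-- The coordinate ring of a surface in `ℂ³` parametrized by a finite polynomial map. -/
theorem ringKrullDim_of_range {S : Set (Fin 3 → ℂ)} (P : Fin 3 → MvPolynomial (Fin 2) ℂ)
    (hS : ∀ p : Fin 2 → ℂ, (fun i => eval p (P i)) ∈ S)
    (hX : ∀ j, (aeval P : MvPolynomial (Fin 3) ℂ →ₐ[ℂ] _).toRingHom.IsIntegralElem (X j))
    {F : MvPolynomial (Fin 3) ℂ} (hF0 : F ≠ 0) (hF : F ∈ idealOf S) :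
    ringKrullDim (MvPolynomial (Fin 3) ℂ ⧸ idealOf S) = 2 := by
  apply le_antisymm
  -- Upper bound: the ideal contains the nonzerodivisor `F`, which costs one of the three
  -- dimensions.
  · have h := ringKrullDim_succ_le_of_surjective (Ideal.Quotient.mk (idealOf S))
      Ideal.Quotient.mk_surjective (mem_nonZeroDivisors_of_ne_zero hF0)
      (Ideal.Quotient.eq_zero_iff_mem.mpr hF)
    rw [MvPolynomial.ringKrullDim_of_isNoetherianRing, ringKrullDim_eq_zero_of_field] at h
    simp only [Nat.card_eq_fintype_card, Fintype.card_fin, zero_add] at h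
    rw [show ((3 : ℕ) : WithBot ℕ∞) = 2 + 1 by norm_num] at h
    exact ENat.WithBot.add_le_add_one_right_iff.mp h
  -- Lower bound: pullback along `P` factors through the coordinate ring, and the two-dimensional
  -- polynomial ring is integral over it.
  · have hker : ∀ f ∈ idealOf S, (aeval P : MvPolynomial (Fin 3) ℂ →ₐ[ℂ] _).toRingHom f = 0 := by
      intro f hf
      refine MvPolynomial.funext fun p => ?_
      have h := mem_vanishingIdeal_iff.mp hf _ (hS p)
      rw [← coe_aeval_eq_eval]
      simp only [AlgHom.toRingHom_eq_coe, RingHom.coe_coe, map_zero]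
      rw [comp_aeval_apply]
      exact h
    have hint := RingHom.IsIntegral.tower_top (Ideal.Quotient.mk (idealOf S))
      (Ideal.Quotient.lift (idealOf S) _ hker) (by
        rw [Ideal.Quotient.lift_comp_mk]
        refine isIntegral_of_forall_X _ (fun a => ?_) hX
        have := RingHom.isIntegralElem_map
          (aeval P : MvPolynomial (Fin 3) ℂ →ₐ[ℂ] _).toRingHom (x := C a)
        simpa using this)
    have h := ringKrullDim_le_of_isIntegral _ hint
    rw [MvPolynomial.ringKrullDim_of_isNoetherianRing, ringKrullDim_eq_zero_of_field] at h
    simpa using h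

/-! ### Generic roots -/

/-- The polynomial `g` is the coefficient of degree `n` times the resultant of `R` and `R' * Q`. Its
nonvanishing at `u` keeps the degree equal to `n`, makes the roots simple and keeps them off the
zeros of `Q`; the point `u₀` shows that `g` is not zero. -/
theorem exists_generic_roots {n : ℕ} (R Q : Polynomial (MvPolynomial (Fin 3) ℂ))
    (hn : R.natDegree ≤ n) (u₀ : Fin 3 → ℂ) (hlead : eval u₀ (R.coeff n) ≠ 0)
    (h0 : ∀ x, (R.map (eval u₀)).eval x = 0 →
      ((Polynomial.derivative R * Q).map (eval u₀)).eval x ≠ 0) :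
    ∃ g : MvPolynomial (Fin 3) ℂ, eval u₀ g ≠ 0 ∧ ∀ u, eval u g ≠ 0 →
      ∃ Z : Finset ℂ, Z.card = n ∧ (∀ x, x ∈ Z ↔ (R.map (eval u)).eval x = 0) ∧
        ∀ x ∈ Z, (Q.map (eval u)).eval x ≠ 0 := by
  set D := Polynomial.derivative R * Q with hD
  have hdeg : ∀ u : Fin 3 → ℂ, eval u (R.coeff n) ≠ 0 → (R.map (eval u)).natDegree = n := by
    intro u hu
    refine le_antisymm (Polynomial.natDegree_map_le.trans hn) ?_
    exact Polynomial.le_natDegree_of_ne_zero (by rwa [Polynomial.coeff_map])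
  -- Up to a power of the leading coefficient, the resultant is the product of the values of `D` at
  -- the roots of `R`. The formal degrees `n` and `D.natDegree` are fixed, so it commutes with
  -- specialization even where the degree of `D` drops.
  have hres : ∀ u : Fin 3 → ℂ, eval u (R.coeff n) ≠ 0 →
      (eval u (R.resultant D n D.natDegree) ≠ 0 ↔
        ∀ x, (R.map (eval u)).eval x = 0 → (D.map (eval u)).eval x ≠ 0) := by
    intro u hu
    have hne : R.map (eval u) ≠ 0 := fun h => hu (by
      rw [← Polynomial.coeff_map, h, Polynomial.coeff_zero])
    have h := Polynomial.resultant_eq_prod_eval (R.map (eval u)) (D.map (eval u)) D.natDegree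
      Polynomial.natDegree_map_le (IsAlgClosed.splits _)
    rw [hdeg u hu, Polynomial.resultant_map_map] at h
    rw [h, mul_ne_zero_iff, ne_eq (Multiset.prod _), Multiset.prod_eq_zero_iff]
    simp only [ne_eq, pow_eq_zero_iff', Polynomial.leadingCoeff_eq_zero, hne, false_and,
      not_false_eq_true, true_and, Multiset.mem_map, Polynomial.mem_roots', Polynomial.IsRoot.def,
      not_exists, not_and]
  refine ⟨R.coeff n * R.resultant D n D.natDegree, ?_, fun u hu => ?_⟩
  · rw [map_mul]
    exact mul_ne_zero hlead ((hres u₀ hlead).mpr h0)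
  · rw [map_mul, mul_ne_zero_iff] at hu
    have hu2 := (hres u hu.1).mp hu.2
    have hne : R.map (eval u) ≠ 0 := fun h => hu.1 (by
      rw [← Polynomial.coeff_map, h, Polynomial.coeff_zero])
    simp only [hD, Polynomial.map_mul, Polynomial.eval_mul, ne_eq, mul_eq_zero, not_or,
      ← Polynomial.derivative_map] at hu2
    refine ⟨(R.map (eval u)).roots.toFinset, ?_, ?_, ?_⟩
    · rw [Multiset.toFinset_card_of_nodup, IsAlgClosed.card_roots_eq_natDegree, hdeg u hu.1]
      refine Multiset.nodup_iff_count_le_one.mpr fun x => ?_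
      rw [Polynomial.count_roots]
      by_contra! hx
      have := (Polynomial.one_lt_rootMultiplicity_iff_isRoot hne).mp hx
      exact (hu2 x this.1).1 this.2
    · simp [hne]
    · intro x hx
      exact (hu2 x (by simpa [hne] using hx)).2

end MomentVariety
end

noncomputable section
namespace MomentVariety
open MvPolynomial

theorem eq_vec_three {v : Fin 3 → ℂ} {a b c : ℂ} (h0 : v 0 = a) (h1 : v 1 = b) (h2 : v 2 = c) :
    v = ![a, b, c] := by
  funext i
  fin_cases i
  exacts [h0, h1, h2]

theorem cons_one_eq_vec (v : Fin 3 → ℂ) :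
    (Fin.cons 1 v : Fin 4 → ℂ) = ![1, v 0, v 1, v 2] := by
  funext i
  fin_cases i <;> rfl

theorem isIntegralElem_aeval {n m : ℕ} (P : Fin n → MvPolynomial (Fin m) ℂ) (i : Fin n) :
    (aeval P : MvPolynomial (Fin n) ℂ →ₐ[ℂ] _).toRingHom.IsIntegralElem (P i) := by
  have := RingHom.isIntegralElem_map
    (aeval P : MvPolynomial (Fin n) ℂ →ₐ[ℂ] _).toRingHom (x := X i)
  simpa using this

/-! ### The Gaussian surface -/

/-- The polynomial parametrization of the Gaussian surface. -/
def gaussianParam : Fin 3 → MvPolynomial (Fin 2) ℂ :=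
  ![X 0, X 1, C 3 * X 0 * X 1 - C 2 * X 0 ^ 3]

/-- The equation of the Gaussian surface. -/
def gaussianEquation : MvPolynomial (Fin 3) ℂ := X 2 - C 3 * X 0 * X 1 + C 2 * X 0 ^ 3

theorem eval_gaussianParam (p : Fin 2 → ℂ) :
    (fun i => eval p (gaussianParam i)) = ![p 0, p 1, 3 * p 0 * p 1 - 2 * p 0 ^ 3] :=
  eq_vec_three (by simp [gaussianParam]) (by simp [gaussianParam]) (by simp [gaussianParam])

theorem affinePatch_gaussianVariety :
    affinePatch (gaussianVariety 3) = {v | v 2 = 3 * v 0 * v 1 - 2 * v 0 ^ 3} := by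
  ext v
  constructor
  · intro hv
    have hF : (X 0 ^ 2 * X 3 - C 3 * (X 0 * (X 1 * X 2)) + C 2 * X 1 ^ 3 :
        MvPolynomial (Fin 4) ℂ).IsHomogeneous 3 :=
      ((((isHomogeneous_X_pow _ 2).mul (isHomogeneous_X _ _)).sub
        (((isHomogeneous_X _ _).mul
          ((isHomogeneous_X _ _).mul (isHomogeneous_X _ _))).C_mul _)).add
        ((isHomogeneous_X_pow _ 3).C_mul _))
    have h := eval_eq_zero_of_mem_affinePatch (fun _ => rfl) hv hF (fun θ => by
      rw [cons_one_eq_vec]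
      simp [gaussianMoment]
      ring)
    rw [cons_one_eq_vec] at h
    simp at h
    show v 2 = 3 * v 0 * v 1 - 2 * v 0 ^ 3
    linear_combination h
  · intro hv
    -- The variance is `y - x²`, so every point of the graph is a moment vector and `D = 1` works.
    have h := eval_mem_affinePatch (m := fun θ : ℂ × ℂ => gaussianMoment θ.1 θ.2)
      (fun _ => rfl) gaussianParam one_ne_zero (fun p _ => ⟨(p 0, p 1 - p 0 ^ 2), fun i => by
        rw [congrFun (eval_gaussianParam p) i]
        fin_cases i
        · rfl
        · simp [gaussianMoment]; ring
        · simp [gaussianMoment]; ring⟩) ![v 0, v 1]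
    rw [eval_gaussianParam] at h
    rw [eq_vec_three rfl rfl hv]
    exact h

theorem gaussianEquation_mem : gaussianEquation ∈ idealOf (affinePatch (gaussianVariety 3)) := by
  rw [affinePatch_gaussianVariety]
  refine mem_vanishingIdeal_iff.mpr fun v hv => ?_
  simp only [Set.mem_ofPred_eq] at hv
  simp [gaussianEquation, hv]

theorem ringKrullDim_gaussian :
    ringKrullDim (MvPolynomial (Fin 3) ℂ ⧸ idealOf (affinePatch (gaussianVariety 3))) = 2 := by
  refine ringKrullDim_of_range gaussianParam (fun p => ?_) (fun j => ?_) (F := gaussianEquation)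
    (fun h => ?_) gaussianEquation_mem
  · rw [affinePatch_gaussianVariety, eval_gaussianParam]
    simp
  · fin_cases j
    exacts [isIntegralElem_aeval gaussianParam 0, isIntegralElem_aeval gaussianParam 1]
  · have := congrArg (eval ![0, 0, 1]) h
    simp [gaussianEquation] at this

theorem gaussian_point_mem (x y : ℂ) :
    ![x, y, 3 * x * y - 2 * x ^ 3] ∈ affinePatch (gaussianVariety 3) := by
  rw [affinePatch_gaussianVariety]
  simp

/-- A graph is regular everywhere; its tangent plane is spanned by the velocities of the two
coordinate curves, with slopes `∂z/∂x = 3y - 6x²` and `∂z/∂y = 3x`. -/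
theorem gaussian_point_mem_criticalPoints_iff {u : Fin 3 → ℂ} (x y : ℂ) :
    ![x, y, 3 * x * y - 2 * x ^ 3] ∈ criticalPoints (affinePatch (gaussianVariety 3)) u ↔
      (x - u 0) + (3 * y - 6 * x ^ 2) * (3 * x * y - 2 * x ^ 3 - u 2) = 0 ∧
        (y - u 1) + 3 * x * (3 * x * y - 2 * x ^ 3 - u 2) = 0 := by
  obtain ⟨hfin, hcrit⟩ := tangent_plane (p := 0) (q := 3 * y - 6 * x ^ 2) (r := 3 * x)
    (T := tangentSpace (affinePatch (gaussianVariety 3)) ![x, y, 3 * x * y - 2 * x ^ 3])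
    (velocity_mem_tangentSpace
      ![Polynomial.X, Polynomial.C y,
        Polynomial.C (3 * y) * Polynomial.X - Polynomial.C 2 * Polynomial.X ^ 3]
      (fun e => by
        convert gaussian_point_mem e y using 1
        refine eq_vec_three (by simp) (by simp) (by simp; ring)) x
      (fun i => by fin_cases i <;> simp; ring)
      (fun i => by fin_cases i <;> simp; ring))
    (velocity_mem_tangentSpace
      ![Polynomial.C x, Polynomial.X,
        Polynomial.C (3 * x) * Polynomial.X - Polynomial.C (2 * x ^ 3)]
      (fun e => by
        convert gaussian_point_mem x e using 1
        refine eq_vec_three (by simp) (by simp) (by simp)) y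
      (fun i => by fin_cases i <;> simp)
      (fun i => by fin_cases i <;> simp [Polynomial.derivative_pow]))
    (fun v hv => by
      have := hv _ gaussianEquation_mem
      simp [gaussianEquation, Fin.sum_univ_three, pderiv_X, Pi.single_apply] at this
      linear_combination this)
  rw [criticalPoints, Set.mem_ofPred_eq, IsRegularPoint, hfin, ringKrullDim_gaussian,
    hcrit fun i => ![x, y, 3 * x * y - 2 * x ^ 3] i - u i]
  simp [gaussian_point_mem]

theorem mem_criticalPoints_gaussian_iff {u v : Fin 3 → ℂ} :
    v ∈ criticalPoints (affinePatch (gaussianVariety 3)) u ↔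
      ∃ x y, v = ![x, y, 3 * x * y - 2 * x ^ 3] ∧
        (x - u 0) + (3 * y - 6 * x ^ 2) * (3 * x * y - 2 * x ^ 3 - u 2) = 0 ∧
        (y - u 1) + 3 * x * (3 * x * y - 2 * x ^ 3 - u 2) = 0 := by
  constructor
  · intro hv
    have h2 : v 2 = 3 * v 0 * v 1 - 2 * v 0 ^ 3 := by
      have := hv.1.1
      rwa [affinePatch_gaussianVariety] at this
    have e := eq_vec_three rfl rfl h2
    exact ⟨v 0, v 1, e, (gaussian_point_mem_criticalPoints_iff _ _).mp (e ▸ hv)⟩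
  · rintro ⟨x, y, rfl, h⟩
    exact (gaussian_point_mem_criticalPoints_iff x y).mpr h

/-! ### The surfaces `x z = α y² + β x² y + γ x⁴` -/

/-- The surface `x z = α y² + β x² y + γ x⁴` in `ℂ³`. -/
def quarticSurface (α β γ : ℂ) : Set (Fin 3 → ℂ) :=
  {v | v 0 * v 2 = α * v 1 ^ 2 + β * v 0 ^ 2 * v 1 + γ * v 0 ^ 4}

/-- A finite polynomial parametrization of `quarticSurface`. -/
def quarticParam (α β γ : ℂ) : Fin 3 → MvPolynomial (Fin 2) ℂ :=
  ![X 0 ^ 2, X 0 * X 1, C α * X 1 ^ 2 + C β * X 0 ^ 3 * X 1 + C γ * X 0 ^ 6]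

/-- The equation of `quarticSurface`. -/
def quarticEquation (α β γ : ℂ) : MvPolynomial (Fin 3) ℂ :=
  X 0 * X 2 - C α * X 1 ^ 2 - C β * X 0 ^ 2 * X 1 - C γ * X 0 ^ 4

theorem eval_quarticParam (α β γ : ℂ) (p : Fin 2 → ℂ) :
    (fun i => eval p (quarticParam α β γ i)) =
      ![p 0 ^ 2, p 0 * p 1, α * p 1 ^ 2 + β * p 0 ^ 3 * p 1 + γ * p 0 ^ 6] :=
  eq_vec_three (by simp [quarticParam]) (by simp [quarticParam]) (by simp [quarticParam])

theorem quarticEquation_mem (α β γ : ℂ) :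
    quarticEquation α β γ ∈ idealOf (quarticSurface α β γ) := by
  refine mem_vanishingIdeal_iff.mpr fun v hv => ?_
  simp only [quarticSurface, Set.mem_ofPred_eq] at hv
  simp [quarticEquation, hv]
  ring

theorem eval_quarticParam_mem (α β γ : ℂ) (p : Fin 2 → ℂ) :
    (fun i => eval p (quarticParam α β γ i)) ∈ quarticSurface α β γ := by
  rw [eval_quarticParam]
  simp [quarticSurface]
  ring

/-- The chart `(x, s)` misses most of the line `x = y = 0`. Taking `x = t²`, `y = tw` covers it too:
`t = √x` and `w = y / t` off the line, `t = 0` and `w = √(z / α)` on it. -/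
theorem exists_eval_quarticParam {α β γ : ℂ} (hα : α ≠ 0) {v : Fin 3 → ℂ}
    (hv : v ∈ quarticSurface α β γ) :
    ∃ p : Fin 2 → ℂ, v = fun i => eval p (quarticParam α β γ i) := by
  simp only [quarticSurface, Set.mem_ofPred_eq] at hv
  simp only [eval_quarticParam]
  by_cases h0 : v 0 = 0
  · obtain ⟨w, hw⟩ := IsAlgClosed.exists_pow_nat_eq (v 2 / α) (n := 2) (by norm_num)
    have h1 : v 1 = 0 := by simpa [h0, hα] using hv
    refine ⟨![0, w], eq_vec_three (by simp [h0]) (by simp [h1]) ?_⟩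
    simp [hw]
    field_simp
  · obtain ⟨t, ht⟩ := IsAlgClosed.exists_pow_nat_eq (v 0) (n := 2) (by norm_num)
    have ht0 : t ≠ 0 := by
      rintro rfl
      exact h0 (by simpa using ht.symm)
    refine ⟨![t, v 1 / t], eq_vec_three (by simp [ht]) ?_ ?_⟩
    · simp
      field_simp
    · simp
      rw [← ht] at hv
      field_simp
      linear_combination hv

theorem ringKrullDim_quarticSurface {α : ℂ} (hα : α ≠ 0) (β γ : ℂ) :
    ringKrullDim (MvPolynomial (Fin 3) ℂ ⧸ idealOf (quarticSurface α β γ)) = 2 := by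
  refine ringKrullDim_of_range (quarticParam α β γ) (eval_quarticParam_mem α β γ) (fun j => ?_)
    (F := quarticEquation α β γ) (fun h => ?_) (quarticEquation_mem α β γ)
  · fin_cases j
    · refine ⟨Polynomial.X ^ 2 - Polynomial.C (X 0), by monicity!, ?_⟩
      simp [quarticParam]
    -- With `x = t²`, the third coordinate gives `w² + α⁻¹(γx³ - z) = -α⁻¹βt³w`; squaring replaces
    -- the odd power `t³` by `t⁶ = x³` and leaves a monic equation for `w`.
    · refine ⟨(Polynomial.X ^ 2 + Polynomial.C (C α⁻¹ * (C γ * X 0 ^ 3 - X 2))) ^ 2 -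
        Polynomial.C (C (α⁻¹ * β) ^ 2 * X 0 ^ 3) * Polynomial.X ^ 2, by monicity!, ?_⟩
      have hC : (C α⁻¹ * C α : MvPolynomial (Fin 2) ℂ) = 1 := by
        rw [← C_mul, inv_mul_cancel₀ hα, C_1]
      simp [quarticParam, Polynomial.eval₂_mul, Polynomial.eval₂_pow]
      linear_combination (C α⁻¹ * C α * X 1 ^ 4 - X 1 ^ 4 + 2 * C α⁻¹ * C β * X 0 ^ 3 * X 1 ^ 3) * hC
  · have := congrArg (eval ![1, 0, γ + 1]) h
    simp [quarticEquation] at this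

theorem quartic_point_mem (α β γ x s : ℂ) :
    ![x, s * x, α * s ^ 2 * x + β * s * x ^ 2 + γ * x ^ 3] ∈ quarticSurface α β γ := by
  simp [quarticSurface]
  ring

/-- The curve `s` constant. It stays valid at `x = 0`, which is what the tangent space at the origin
requires. -/
theorem quartic_velocity_left (α β γ x s : ℂ) :
    ![1, s, α * s ^ 2 + 2 * β * s * x + 3 * γ * x ^ 2] ∈ tangentSpace (quarticSurface α β γ)
      ![x, s * x, α * s ^ 2 * x + β * s * x ^ 2 + γ * x ^ 3] :=
  velocity_mem_tangentSpace
    ![Polynomial.X, Polynomial.C s * Polynomial.X,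
      Polynomial.C (α * s ^ 2) * Polynomial.X + Polynomial.C (β * s) * Polynomial.X ^ 2 +
        Polynomial.C γ * Polynomial.X ^ 3]
    (fun e => by
      convert quartic_point_mem α β γ e s using 1
      refine eq_vec_three (by simp) (by simp) (by simp)) x
    (fun i => by fin_cases i <;> simp)
    (fun i => by fin_cases i <;> simp [Polynomial.derivative_pow]; ring)

theorem quartic_velocity_right (α β γ x s : ℂ) :
    ![0, x, (2 * α * s + β * x) * x] ∈ tangentSpace (quarticSurface α β γ)
      ![x, s * x, α * s ^ 2 * x + β * s * x ^ 2 + γ * x ^ 3] :=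
  velocity_mem_tangentSpace
    ![Polynomial.C x, Polynomial.X * Polynomial.C x,
      Polynomial.C (α * x) * Polynomial.X ^ 2 + Polynomial.C (β * x ^ 2) * Polynomial.X +
        Polynomial.C (γ * x ^ 3)]
    (fun e => by
      convert quartic_point_mem α β γ x e using 1
      refine eq_vec_three (by simp) (by simp; ring) (by simp; ring)) s
    (fun i => by fin_cases i <;> simp <;> ring)
    (fun i => by fin_cases i <;> simp [Polynomial.derivative_pow]; ring)

/-- Where `x ≠ 0` the surface is a graph over the first two coordinates; dividing the velocity of
the curve `x` constant by `x` puts the tangent plane in the form of `tangent_plane`. -/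
theorem quartic_point_mem_criticalPoints_iff {α : ℂ} (hα : α ≠ 0) (β γ : ℂ) {x : ℂ} (hx : x ≠ 0)
    (s : ℂ) (u : Fin 3 → ℂ) :
    ![x, s * x, α * s ^ 2 * x + β * s * x ^ 2 + γ * x ^ 3] ∈
        criticalPoints (quarticSurface α β γ) u ↔
      (x - u 0) + s * (s * x - u 1) + (α * s ^ 2 + 2 * β * s * x + 3 * γ * x ^ 2) *
          (α * s ^ 2 * x + β * s * x ^ 2 + γ * x ^ 3 - u 2) = 0 ∧
        (s * x - u 1) + (2 * α * s + β * x) *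
          (α * s ^ 2 * x + β * s * x ^ 2 + γ * x ^ 3 - u 2) = 0 := by
  obtain ⟨hfin, hcrit⟩ := tangent_plane (quartic_velocity_left α β γ x s) (r := 2 * α * s + β * x)
    (by
      have := Submodule.smul_mem _ x⁻¹ (quartic_velocity_right α β γ x s)
      convert this using 1
      refine (eq_vec_three ?_ ?_ ?_).symm <;> simp <;> field_simp)
    (fun v hv => by
      have := hv _ (quarticEquation_mem α β γ)
      simp [quarticEquation, Fin.sum_univ_three, pderiv_X, Pi.single_apply] at this
      refine mul_left_cancel₀ hx ?_
      linear_combination this)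
  rw [criticalPoints, Set.mem_ofPred_eq, IsRegularPoint, hfin, ringKrullDim_quarticSurface hα,
    hcrit fun i => ![x, s * x, α * s ^ 2 * x + β * s * x ^ 2 + γ * x ^ 3] i - u i]
  simp [quartic_point_mem]

/-- The second coordinate direction is tangent to the surface along the line `x = y = 0`. -/
theorem quartic_tangent_line {α : ℂ} (hα : α ≠ 0) (β γ z : ℂ) :
    ![0, 1, 0] ∈ tangentSpace (quarticSurface α β γ) ![0, 0, z] := by
  by_cases hz : z = 0
  · subst hz
    -- At the origin, the curves `s = 1` and `s = -1` have velocities whose difference is `(0, 2,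
    -- 0)`.
    have h1 : ![1, 1, α] ∈ tangentSpace (quarticSurface α β γ) ![0, 0, 0] := by
      simpa using quartic_velocity_left α β γ 0 1
    have h2 : ![1, -1, α] ∈ tangentSpace (quarticSurface α β γ) ![0, 0, 0] := by
      simpa using quartic_velocity_left α β γ 0 (-1)
    have h3 := Submodule.smul_mem _ (2⁻¹ : ℂ) (sub_mem h1 h2)
    convert h3 using 1
    refine (eq_vec_three ?_ ?_ ?_).symm
    · show (2⁻¹ : ℂ) * (1 - 1) = 0
      ring
    · show (2⁻¹ : ℂ) * (1 - -1) = 1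
      ring
    · show (2⁻¹ : ℂ) * (α - α) = 0
      ring
  -- Off the origin, the curve `t ↦ (t², tw, …)` with `αw² = z` passes through the point at `t = 0`
  -- with velocity `(0, w, 0)`.
  · obtain ⟨w, hw⟩ := IsAlgClosed.exists_pow_nat_eq (z / α) (n := 2) (by norm_num)
    have hz' : α * w ^ 2 = z := by
      rw [hw]
      field_simp
    have hw0 : w ≠ 0 := by
      rintro rfl
      exact hz (by simpa using hz'.symm)
    have h : ![0, w, 0] ∈ tangentSpace (quarticSurface α β γ) ![0, 0, z] :=
      velocity_mem_tangentSpace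
        ![Polynomial.X ^ 2, Polynomial.X * Polynomial.C w,
          Polynomial.C (α * w ^ 2) + Polynomial.C (β * w) * Polynomial.X ^ 3 +
            Polynomial.C γ * Polynomial.X ^ 6]
        (fun e => by
          convert eval_quarticParam_mem α β γ ![e, w] using 1
          rw [eval_quarticParam]
          refine eq_vec_three (by simp) (by simp; ring) (by simp; ring)) 0
        (fun i => by fin_cases i <;> simp [hz'])
        (fun i => by fin_cases i <;> simp [Polynomial.derivative_pow])
    convert Submodule.smul_mem _ w⁻¹ h using 1
    refine (eq_vec_three ?_ ?_ ?_).symm <;> simp [hw0]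

/-- On the line `x = y = 0`, criticality along `(0, 1, 0)` would force `u 1 = 0`, so no discussion
of regularity there is needed. -/
theorem mem_criticalPoints_quartic_iff {α : ℂ} (hα : α ≠ 0) (β γ : ℂ) {u v : Fin 3 → ℂ}
    (hu : u 1 ≠ 0) :
    v ∈ criticalPoints (quarticSurface α β γ) u ↔
      ∃ x s, x ≠ 0 ∧ v = ![x, s * x, α * s ^ 2 * x + β * s * x ^ 2 + γ * x ^ 3] ∧
      (x - u 0) + s * (s * x - u 1) + (α * s ^ 2 + 2 * β * s * x + 3 * γ * x ^ 2) *
          (α * s ^ 2 * x + β * s * x ^ 2 + γ * x ^ 3 - u 2) = 0 ∧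
        (s * x - u 1) + (2 * α * s + β * x) *
          (α * s ^ 2 * x + β * s * x ^ 2 + γ * x ^ 3 - u 2) = 0 := by
  constructor
  · intro hv
    have hmem : v 0 * v 2 = α * v 1 ^ 2 + β * v 0 ^ 2 * v 1 + γ * v 0 ^ 4 := hv.1.1
    by_cases h0 : v 0 = 0
    · exfalso
      have h1 : v 1 = 0 := by simpa [h0, hα] using hmem
      have e := eq_vec_three h0 h1 rfl
      have := hv.2 ![0, 1, 0] (by rw [e]; exact quartic_tangent_line hα β γ _)
      simp [Fin.sum_univ_three, h1, hu] at this
    · have e : v = ![v 0, v 1 / v 0 * v 0, α * (v 1 / v 0) ^ 2 * v 0 +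
          β * (v 1 / v 0) * v 0 ^ 2 + γ * v 0 ^ 3] := by
        refine eq_vec_three rfl (by field_simp) ?_
        field_simp
        linear_combination hmem
      exact ⟨v 0, v 1 / v 0, h0, e,
        (quartic_point_mem_criticalPoints_iff hα β γ h0 _ u).mp (e ▸ hv)⟩
  · rintro ⟨x, s, hx, rfl, h⟩
    exact (quartic_point_mem_criticalPoints_iff hα β γ hx s u).mpr h

/-! ### The inverse Gaussian and gamma surfaces -/

theorem affinePatch_inverseGaussianVariety :
    affinePatch (inverseGaussianVariety 3) = quarticSurface 3 (-3) 1 := by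
  ext v
  constructor
  · intro hv
    have hF : (X 0 ^ 2 * (X 1 * X 3) - C 3 * (X 0 ^ 2 * X 2 ^ 2) + C 3 * (X 0 * (X 1 ^ 2 * X 2))
        - X 1 ^ 4 : MvPolynomial (Fin 4) ℂ).IsHomogeneous 4 :=
      ((((isHomogeneous_X_pow _ 2).mul ((isHomogeneous_X _ _).mul (isHomogeneous_X _ _))).sub
        (((isHomogeneous_X_pow _ 2).mul (isHomogeneous_X_pow _ 2)).C_mul _)).add
        (((isHomogeneous_X _ _).mul ((isHomogeneous_X_pow _ 2).mul
          (isHomogeneous_X _ _))).C_mul _)).sub (isHomogeneous_X_pow _ 4)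
    have h := eval_eq_zero_of_mem_affinePatch (fun _ => rfl) hv hF (fun θ => by
      rw [cons_one_eq_vec]
      simp [inverseGaussianMoment]
      ring)
    rw [cons_one_eq_vec] at h
    simp at h
    show v 0 * v 2 = _
    linear_combination h
  · intro hv
    obtain ⟨p, rfl⟩ := exists_eval_quarticParam three_ne_zero hv
    refine eval_mem_affinePatch (m := fun θ : ℂ × ℂ => inverseGaussianMoment θ.1 θ.2)
      (fun _ => rfl) _ (X_ne_zero 0) (fun q hq => ?_) p
    rw [eval_X] at hq
    -- Solves `x = μ` and `y = νμ³ + μ²` for `x = t²`, `y = tw`.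
    refine ⟨(q 0 ^ 2, (q 0 * q 1 - q 0 ^ 4) / q 0 ^ 6), fun i => ?_⟩
    rw [congrFun (eval_quarticParam _ _ _ q) i]
    fin_cases i
    · rfl
    · simp [inverseGaussianMoment]; field_simp; ring
    · simp [inverseGaussianMoment]; field_simp; ring

theorem affinePatch_gammaVariety :
    affinePatch (gammaVariety 3) = quarticSurface 2 (-1) 0 := by
  ext v
  constructor
  · intro hv
    have hF : (X 0 * (X 1 * X 3) - C 2 * (X 0 * X 2 ^ 2) + X 1 ^ 2 * X 2
        : MvPolynomial (Fin 4) ℂ).IsHomogeneous 3 :=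
      ((((isHomogeneous_X _ _).mul ((isHomogeneous_X _ _).mul (isHomogeneous_X _ _))).sub
        (((isHomogeneous_X _ _).mul (isHomogeneous_X_pow _ 2)).C_mul _)).add
        ((isHomogeneous_X_pow _ 2).mul (isHomogeneous_X _ _)))
    have h := eval_eq_zero_of_mem_affinePatch (fun _ => by simp [gammaMoment]) hv hF (fun θ => by
      rw [cons_one_eq_vec]
      simp [gammaMoment, Finset.prod_range_succ]
      ring)
    rw [cons_one_eq_vec] at h
    simp at h
    show v 0 * v 2 = _
    linear_combination h
  · intro hv
    obtain ⟨p, rfl⟩ := exists_eval_quarticParam two_ne_zero hv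
    refine eval_mem_affinePatch (m := fun θ : ℂ × ℂ => gammaMoment θ.1 θ.2)
      (D := X 0 * (X 1 - X 0 ^ 3)) (fun _ => by simp [gammaMoment]) _ (fun h => ?_)
      (fun q hq => ?_) p
    · have := congrArg (eval ![1, 0]) h
      simp at this
    · simp at hq
      obtain ⟨h0, h1⟩ := hq
      -- The scale is `(y - x²) / x` and the shape is `x` divided by the scale; `D` excludes `x = 0`
      -- and scale zero.
      refine ⟨(q 0 ^ 3 / (q 1 - q 0 ^ 3), (q 1 - q 0 ^ 3) / q 0), fun i => ?_⟩
      rw [congrFun (eval_quarticParam _ _ _ q) i]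
      fin_cases i
      · simp [gammaMoment]; field_simp
      · simp [gammaMoment, Finset.prod_range_succ]; field_simp; ring
      · simp [gammaMoment, Finset.prod_range_succ]; field_simp; ring

end MomentVariety
end

noncomputable section
namespace MomentVariety
open MvPolynomial

/-! ### Elimination -/

/-- The eliminant in `x` of the critical equations of the inverse Gaussian surface. -/
def inverseGaussianResultant {A : Type*} [CommRing A] (a b c x : A) : A :=
  108 * x ^ 12 + (-324 * b + 486) * x ^ 10 + (-162 * a - 486 * c) * x ^ 9 + (324 * b ^ 2 - 1980 *
  b + 1281) * x ^ 8 + (486 * a * b - 1521 * a + 1134 * b * c - 918 * c) * x ^ 7 + (243 * a ^ 2 +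
  567 * a * c + 2538 * b ^ 2 - 3900 * b + 405 * c ^ 2 + 1632) * x ^ 6 + (3888 * a * b - 3144 * a -
  1134 * b ^ 2 * c + 2583 * b * c - 1236 * c) * x ^ 5 + (1512 * a ^ 2 - 1944 * a * b * c + 2205 *
  a * c - 1566 * b ^ 3 + 4173 * b ^ 2 - 81 * b * c ^ 2 - 3996 * b - 297 * c ^ 2 + 1225) * x ^ 4 +
  (-972 * a ^ 2 * c - 4158 * a * b ^ 2 + 7884 * a * b + 324 * a * c ^ 2 - 3745 * a - 189 * b ^ 2 *
  c - 321 * b * c - 27 * c ^ 3 + 420 * c) * x ^ 3 + (-3888 * a ^ 2 * b + 3816 * a ^ 2 + 324 * a *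
  b * c - 852 * a * c + 81 * b ^ 2 * c ^ 2 + 72 * b ^ 2 - 36 * b * c ^ 2 + 36 * c ^ 2) * x ^ 2 +
  (-1296 * a ^ 3 + 432 * a ^ 2 * c - 72 * a * b ^ 2 - 36 * a * c ^ 2 + 108 * b ^ 3 * c - 105 * b ^
  2 * c) * x + (108 * a * b ^ 2 * c - 9 * b ^ 4)

/-- The leading coefficient of the linear equation for `s` on the inverse Gaussian surface. -/
def inverseGaussianLead {A : Type*} [CommRing A] (a b c x : A) : A :=
  (-54) * x ^ 6 + (162 * b - 57) * x ^ 4 + (162 * a - 27 * c) * x ^ 3 + (-54 * b - 35) * x ^ 2 +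
  (36 * a - 6 * c) * x + 18 * b ^ 2

/-- The constant coefficient of the linear equation for `s` on the inverse Gaussian surface. -/
def inverseGaussianConst {A : Type*} [CommRing A] (a b c x : A) : A :=
  54 * x ^ 7 + (-108 * b + 78) * x ^ 5 + (-81 * a - 54 * c) * x ^ 4 + (-90 * b + 108) * x ^ 3 +
  (-108 * a + 27 * b * c + 3 * c) * x ^ 2 + (27 * b ^ 2 - 37 * b) * x + 36 * a * b

/-- A quadratic consequence in `s` of the critical equations of the inverse Gaussian surface. -/
def inverseGaussianQuadratic {A : Type*} [CommRing A] (a b c x s : A) : A :=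
  (9 * x ^ 3 + 2 * x) * s ^ 2 + (-9 * x ^ 4 + 3 * x ^ 2 - 2 * b) * s + (3 * x ^ 5 - 3 * x ^ 2 * c
  - 3 * x * b + 4 * x - 4 * a)

/-- Pseudo-division in `s` of the first critical equation, a quartic, by the second, a cubic with
leading coefficient `18x`. The next two identities continue this Euclidean algorithm down to a
polynomial in `x`. -/
theorem inverseGaussian_quadratic_identity (a b c x s : ℂ) :
    (81 * x ^ 2) * inverseGaussianQuadratic a b c x s = (18 * x) ^ 2 * ((x - a) + s * (s * x -
    b) + (3 * s ^ 2 + 2 * -3 * s * x + 3 * 1 * x ^ 2) * (3 * s ^ 2 * x + -3 * s * x ^ 2 + 1 * x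
    ^ 3 - c)) -
      ((18 * x) ^ 2 * s + (-243 * x ^ 3 - 162 * x ^ 2 * s)) * ((s * x - b) + (2 * 3 * s + -3 *
      x) * (3 * s ^ 2 * x + -3 * s * x ^ 2 + 1 * x ^ 3 - c)) := by
  simp only [inverseGaussianQuadratic]
  ring

theorem inverseGaussian_linear_identity (a b c x s : ℂ) :
    (4 * x) * (inverseGaussianLead a b c x * s + inverseGaussianConst a b c x) = (9 * x ^ 3 + 2
    * x) ^ 2 *
      ((s * x - b) + (2 * 3 * s + -3 * x) * (3 * s ^ 2 * x + -3 * s * x ^ 2 + 1 * x ^ 3 - c))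
      - (-81 * x ^ 5 + 162 * x ^ 4 * s - 108 * x ^ 3 + 36 * x ^ 2 * s + 36 * x * b) *
      inverseGaussianQuadratic a b c x s := by
  simp only [inverseGaussianLead, inverseGaussianConst, inverseGaussianQuadratic]
  ring

theorem inverseGaussian_resultant_identity (a b c x s : ℂ) :
    (x) * (9 * x ^ 2 + 2) ^ 2 * inverseGaussianResultant a b c x = inverseGaussianLead a b c x ^
    2 * inverseGaussianQuadratic a b c x s -
      ((-486 * s) * x ^ 9 + (-486 * b - 459) * x ^ 8 + (1458 * s * b - 621 * s - 729 * a + 729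
      * c) * x ^ 7 + (1458 * s * a - 243 * s * c + 2106 * b - 984) * x ^ 6 + (-162 * s * b -
      429 * s + 1296 * a - 243 * b * c + 54 * c) * x ^ 5 + (648 * s * a - 108 * s * c - 729 *
      b ^ 2 + 465 * b - 321) * x ^ 4 + (162 * s * b ^ 2 - 108 * s * b - 70 * s - 648 * a * b +
      324 * a - 24 * c) * x ^ 3 + (72 * s * a - 12 * s * c + 108 * b ^ 2 + 144 * b) * x ^ 2 +
      (36 * s * b ^ 2 - 144 * a * b + 12 * b * c) * x + (-36 * b ^ 3)) * (inverseGaussianLead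
      a b c x * s + inverseGaussianConst a b c x) := by
  simp only [inverseGaussianResultant, inverseGaussianLead, inverseGaussianConst, inverseGaussianQuadratic]
  ring

/-- The Euclidean chain yields the eliminant only up to the extraneous factor `(9x² + 2)²`. This
membership avoids that factor, so that `R = 0` follows from `x ≠ 0` alone. -/
theorem inverseGaussian_resultant_mem (a b c x s : ℂ) :
    4 * x ^ 2 * inverseGaussianResultant a b c x = (486 * s * x ^ 10 + (-972 * s ^ 2 + 486 * b +
    603) * x ^ 9 + (-2430 * s * b + 135 * s + 729 * a - 729 * c) * x ^ 8 + (2916 * s ^ 2 * b -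
    1026 * s ^ 2 - 2916 * s * a + 1701 * s * c - 2538 * b + 1632) * x ^ 7 + (2916 * s ^ 2 * a -
    486 * s ^ 2 * c + 3078 * s * b - 999 * s - 1512 * a + 243 * b * c - 558 * c) * x ^ 6 + (-972
    * s ^ 2 * b - 630 * s ^ 2 + 972 * s * a - 486 * s * b * c + 108 * s * c + 1809 * b ^ 2 -
    2997 * b + 1225) * x ^ 5 + (648 * s ^ 2 * a - 108 * s ^ 2 * c - 972 * s * b ^ 2 + 666 * s *
    b + 2916 * a * b - 2520 * a + 108 * b * c + 420 * c) * x ^ 4 + (324 * s ^ 2 * b ^ 2 - 648 *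
    s * a * b + 1296 * a ^ 2 - 432 * a * c + 36 * b ^ 2 + 36 * c ^ 2) * x ^ 3 + (-108 * b ^ 2 *
    c) * x ^ 2) * inverseGaussianQuadratic a b c x s -
      ((-486 * s) * x ^ 11 + (-486 * b - 459) * x ^ 10 + (1458 * s * b - 621 * s - 729 * a +
      729 * c) * x ^ 9 + (1458 * s * a - 243 * s * c + 2106 * b - 984) * x ^ 8 + (-162 * s * b
      - 429 * s + 1296 * a - 243 * b * c + 54 * c) * x ^ 7 + (648 * s * a - 108 * s * c - 729
      * b ^ 2 + 465 * b - 321) * x ^ 6 + (162 * s * b ^ 2 - 108 * s * b - 70 * s - 648 * a * b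
      + 324 * a - 24 * c) * x ^ 5 + (72 * s * a - 12 * s * c + 108 * b ^ 2 + 144 * b) * x ^ 4
      + (36 * s * b ^ 2 - 144 * a * b + 12 * b * c) * x ^ 3 + (-36 * b ^ 3) * x ^ 2) * ((s * x
      - b) + (2 * 3 * s + -3 * x) * (3 * s ^ 2 * x + -3 * s * x ^ 2 + 1 * x ^ 3 - c)) := by
  simp only [inverseGaussianResultant, inverseGaussianQuadratic]
  ring

/-- The eliminant in `s` of the critical equations of the gamma surface. -/
def gammaResultant {A : Type*} [CommRing A] (a b c s : A) : A :=
  (-96 * b) * s ^ 10 + (-192 * a + 48 * c) * s ^ 9 + (48 * b ^ 2 - 52 * b) * s ^ 8 + (120 * a * b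
  - 128 * a - 12 * b * c + 122 * c) * s ^ 7 + (48 * a ^ 2 + 84 * a * c + 32 * b + 6 * c ^ 2) * s ^
  6 + (18 * a * b + 3 * a + 6 * b ^ 2 * c - 59 * b * c + 48 * c) * s ^ 5 + (-18 * a ^ 2 - 12 * a *
  b * c - 13 * a * c + b ^ 3 - 12 * b ^ 2 + 9 * b - 12 * c ^ 2) * s ^ 4 + (6 * a ^ 2 * c - 3 * a *
  b ^ 2 + 6 * a * b - 6 * a - 2 * b * c - 6 * c) * s ^ 3 + (3 * a ^ 2 * b + 6 * a ^ 2 + 2 * a * c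
  - 2 * b + 6 * c ^ 2) * s ^ 2 + (-a ^ 3 - a + b * c + 4 * c) * s + (-a * c + b)

/-- The leading coefficient of the linear equation for `x` on the gamma surface. -/
def gammaLead {A : Type*} [CommRing A] (a b s : A) : A :=
  24 * s ^ 6 + (-6 * b + 13) * s ^ 4 + 6 * a * s ^ 3 + (-2) * s ^ 2 + 1

/-- The constant coefficient of the linear equation for `x` on the gamma surface. -/
def gammaConst {A : Type*} [CommRing A] (a b c s : A) : A :=
  (-12 * b) * s ^ 5 + (-24 * a - 6 * c) * s ^ 4 + (-b) * s ^ 3 + (a + 6 * c) * s ^ 2 + b * s +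
  (-a)

/-- A quadratic consequence in `x` of the critical equations of the gamma surface. -/
def gammaQuadratic {A : Type*} [CommRing A] (a b c x s : A) : A :=
  6 * s ^ 3 * x ^ 2 + (-12 * s ^ 4 - s ^ 2 + 1) * x + (6 * s ^ 2 * c + s * b - a)

theorem gamma_quadratic_identity (a b c x s : ℂ) :
    (s) * gammaQuadratic a b c x s = (s) ^ 1 * ((x - a) + s * (s * x - b) + (2 * s ^ 2 + 2 * -1
    * s * x + 3 * 0 * x ^ 2) * (2 * s ^ 2 * x + -1 * s * x ^ 2 + 0 * x ^ 3 - c)) -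
      ((s) ^ 1 * s + (s ^ 2)) * ((s * x - b) + (2 * 2 * s + -1 * x) * (2 * s ^ 2 * x + -1 * s
      * x ^ 2 + 0 * x ^ 3 - c)) := by
  simp only [gammaQuadratic]
  ring

theorem gamma_linear_identity (a b c x s : ℂ) :
    (s) * (gammaLead a b s * x + gammaConst a b c s) = (6 * s ^ 3) ^ 2 *
      ((s * x - b) + (2 * 2 * s + -1 * x) * (2 * s ^ 2 * x + -1 * s * x ^ 2 + 0 * x ^ 3 - c))
      - (6 * x * s ^ 4 - 24 * s ^ 5 + s ^ 3 - s) * gammaQuadratic a b c x s := by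
  simp only [gammaLead, gammaConst, gammaQuadratic]
  ring

/-- Here `x` is eliminated and `s` kept. The extraneous factor is only a power of `s`, so no
separate membership identity is needed. -/
theorem gamma_resultant_identity (a b c x s : ℂ) :
    (36 * s ^ 5) * gammaResultant a b c s = gammaLead a b s ^ 2 * gammaQuadratic a b c x s -
      ((-288) * s ^ 10 + 144 * x * s ^ 9 + (144 * b - 180) * s ^ 8 + (-36 * x * b + 78 * x +
      72 * a + 36 * c) * s ^ 7 + (36 * x * a + 12 * b + 35) * s ^ 6 + (-12 * x - 12 * a - 36 *
      c) * s ^ 5 + (-12 * b + 3) * s ^ 4 + (6 * x + 12 * a) * s ^ 3 + (-3) * s ^ 2 + 1) *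
      (gammaLead a b s * x + gammaConst a b c s) := by
  simp only [gammaResultant, gammaLead, gammaConst, gammaQuadratic]
  ring

end MomentVariety
end

/-! ### Critical equations versus roots of the eliminants -/

noncomputable section
namespace MomentVariety
open MvPolynomial

/-- Every pseudo-division step is reversible once the multipliers `x`, `9x² + 2` and the leading
coefficient of the linear equation are nonzero. -/
theorem inverseGaussian_elim {a b c x s : ℂ} (hx : x ≠ 0)
    (hL : inverseGaussianLead a b c x ≠ 0) (h2 : 9 * x ^ 2 + 2 ≠ 0) :
    ((x - a) + s * (s * x - b) + (3 * s ^ 2 + 2 * -3 * s * x + 3 * 1 * x ^ 2) *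
        (3 * s ^ 2 * x + -3 * s * x ^ 2 + 1 * x ^ 3 - c) = 0 ∧
      (s * x - b) + (2 * 3 * s + -3 * x) *
        (3 * s ^ 2 * x + -3 * s * x ^ 2 + 1 * x ^ 3 - c) = 0) ↔
    inverseGaussianResultant a b c x = 0 ∧
      s = -inverseGaussianConst a b c x / inverseGaussianLead a b c x := by
  have i1 := inverseGaussian_quadratic_identity a b c x s
  have i2 := inverseGaussian_linear_identity a b c x s
  have i3 := inverseGaussian_resultant_identity a b c x s
  rw [eq_div_iff hL]
  constructor
  · rintro ⟨hB, hA⟩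
    rw [hA, hB, mul_zero, mul_zero, sub_zero] at i1
    have hQ : inverseGaussianQuadratic a b c x s = 0 := by simpa [hx] using i1
    rw [hA, hQ, mul_zero, mul_zero, sub_zero] at i2
    have hlin : inverseGaussianLead a b c x * s + inverseGaussianConst a b c x = 0 := by
      simpa [hx] using i2
    rw [hlin, hQ, mul_zero, mul_zero, sub_zero] at i3
    exact ⟨by simpa [hx, h2] using i3, by linear_combination hlin⟩
  · rintro ⟨hR, hs⟩
    have hlin : inverseGaussianLead a b c x * s + inverseGaussianConst a b c x = 0 := by
      linear_combination hs
    rw [hR, hlin, mul_zero, mul_zero, sub_zero] at i3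
    have hQ : inverseGaussianQuadratic a b c x s = 0 := by simpa [hL] using i3.symm
    rw [hQ, hlin, mul_zero, mul_zero, sub_zero] at i2
    have h9 : (9 * x ^ 3 + 2 * x) ^ 2 ≠ 0 := by
      rw [show 9 * x ^ 3 + 2 * x = x * (9 * x ^ 2 + 2) by ring]
      exact pow_ne_zero 2 (mul_ne_zero hx h2)
    have hA := (mul_eq_zero.mp i2.symm).resolve_left h9
    rw [hQ, hA, mul_zero, mul_zero, sub_zero] at i1
    exact ⟨(mul_eq_zero.mp i1.symm).resolve_left (by simp [hx]), hA⟩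

theorem inverseGaussian_resultant_eq_zero {a b c x s : ℂ} (hx : x ≠ 0)
    (hB : (x - a) + s * (s * x - b) + (3 * s ^ 2 + 2 * -3 * s * x + 3 * 1 * x ^ 2) *
        (3 * s ^ 2 * x + -3 * s * x ^ 2 + 1 * x ^ 3 - c) = 0)
    (hA : (s * x - b) + (2 * 3 * s + -3 * x) *
        (3 * s ^ 2 * x + -3 * s * x ^ 2 + 1 * x ^ 3 - c) = 0) :
    inverseGaussianResultant a b c x = 0 := by
  have i1 := inverseGaussian_quadratic_identity a b c x s
  have i2 := inverseGaussian_resultant_mem a b c x s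
  rw [hA, hB, mul_zero, mul_zero, sub_zero] at i1
  have hQ : inverseGaussianQuadratic a b c x s = 0 := by simpa [hx] using i1
  rw [hA, hQ, mul_zero, mul_zero, sub_zero] at i2
  simpa [hx] using i2

theorem gamma_consequences {a b c x s : ℂ} (hs : s ≠ 0)
    (hB : (x - a) + s * (s * x - b) + (2 * s ^ 2 + 2 * -1 * s * x + 3 * 0 * x ^ 2) *
        (2 * s ^ 2 * x + -1 * s * x ^ 2 + 0 * x ^ 3 - c) = 0)
    (hA : (s * x - b) + (2 * 2 * s + -1 * x) *
        (2 * s ^ 2 * x + -1 * s * x ^ 2 + 0 * x ^ 3 - c) = 0) :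
    gammaResultant a b c s = 0 ∧ gammaLead a b s * x + gammaConst a b c s = 0 := by
  have i1 := gamma_quadratic_identity a b c x s
  have i2 := gamma_linear_identity a b c x s
  have i3 := gamma_resultant_identity a b c x s
  rw [hA, hB, mul_zero, mul_zero, sub_zero] at i1
  have hQ : gammaQuadratic a b c x s = 0 := by simpa [hs] using i1
  rw [hA, hQ, mul_zero, mul_zero, sub_zero] at i2
  have hlin : gammaLead a b s * x + gammaConst a b c s = 0 := by simpa [hs] using i2
  rw [hlin, hQ, mul_zero, mul_zero, sub_zero] at i3
  exact ⟨by simpa [hs] using i3, hlin⟩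

theorem gamma_critical_of_linear {a b c x s : ℂ} (hs : s ≠ 0) (hL : gammaLead a b s ≠ 0)
    (hR : gammaResultant a b c s = 0) (hlin : gammaLead a b s * x + gammaConst a b c s = 0) :
    (x - a) + s * (s * x - b) + (2 * s ^ 2 + 2 * -1 * s * x + 3 * 0 * x ^ 2) *
        (2 * s ^ 2 * x + -1 * s * x ^ 2 + 0 * x ^ 3 - c) = 0 ∧
      (s * x - b) + (2 * 2 * s + -1 * x) *
        (2 * s ^ 2 * x + -1 * s * x ^ 2 + 0 * x ^ 3 - c) = 0 := by
  have i1 := gamma_quadratic_identity a b c x s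
  have i2 := gamma_linear_identity a b c x s
  have i3 := gamma_resultant_identity a b c x s
  rw [hR, hlin, mul_zero, mul_zero, sub_zero] at i3
  have hQ : gammaQuadratic a b c x s = 0 := by simpa [hL] using i3.symm
  rw [hQ, hlin, mul_zero, mul_zero, sub_zero] at i2
  have hA := (mul_eq_zero.mp i2.symm).resolve_left (by simp [hs])
  rw [hQ, hA] at i1
  exact ⟨mul_left_cancel₀ hs (by linear_combination -i1), hA⟩

/-- The eliminant in `x` of the critical equations of the Gaussian surface. -/
def gaussianResultant {A : Type*} [CommRing A] (a b c x : A) : A :=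
  72 * x ^ 7 + (-108 * b + 93) * x ^ 5 + (-81 * a + 18 * c) * x ^ 4 + (-24 * b + 18) * x ^ 3 +
  (-18 * a + 27 * b * c + 6 * c) * x ^ 2 + (9 * b ^ 2 - 9 * c ^ 2 + 1) * x + (-a - 3 * b * c)

/-- The second critical equation is linear in `y`, namely `(1 + 9x²)y = b + 6x⁴ + 3cx`; substituting
into the first and clearing `(1 + 9x²)²` gives the eliminant. -/
theorem gaussian_resultant_identity (a b c x y : ℂ) :
    gaussianResultant a b c x = (1 + 9 * x ^ 2) ^ 2 *
        ((x - a) + (3 * y - 6 * x ^ 2) * (3 * x * y - 2 * x ^ 3 - c)) +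
      (9 * x * (y * (1 + 9 * x ^ 2) - (b + 6 * x ^ 4 + 3 * c * x)) -
        3 * x * (1 + 9 * x ^ 2) * (3 * y - 6 * x ^ 2) -
        3 * (1 + 9 * x ^ 2) * (3 * x * y - 2 * x ^ 3 - c)) *
      (y * (1 + 9 * x ^ 2) - (b + 6 * x ^ 4 + 3 * c * x)) := by
  simp only [gaussianResultant]
  ring

theorem gaussian_elim {a b c x y : ℂ} (h9 : 1 + 9 * x ^ 2 ≠ 0) :
    ((x - a) + (3 * y - 6 * x ^ 2) * (3 * x * y - 2 * x ^ 3 - c) = 0 ∧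
      (y - b) + 3 * x * (3 * x * y - 2 * x ^ 3 - c) = 0) ↔
    gaussianResultant a b c x = 0 ∧ y = (b + 6 * x ^ 4 + 3 * c * x) / (1 + 9 * x ^ 2) := by
  have i := gaussian_resultant_identity a b c x y
  rw [eq_div_iff h9]
  constructor
  · rintro ⟨h1, h2⟩
    have hy : y * (1 + 9 * x ^ 2) - (b + 6 * x ^ 4 + 3 * c * x) = 0 := by linear_combination h2
    rw [h1, hy, mul_zero, mul_zero, add_zero] at i
    exact ⟨i, by linear_combination hy⟩
  · rintro ⟨hR, hy⟩
    rw [hR, hy, sub_self, mul_zero, add_zero] at i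
    exact ⟨(mul_eq_zero.mp i.symm).resolve_left (pow_ne_zero 2 h9), by linear_combination hy⟩

theorem gaussian_resultant_eq_zero {a b c x y : ℂ}
    (h1 : (x - a) + (3 * y - 6 * x ^ 2) * (3 * x * y - 2 * x ^ 3 - c) = 0)
    (h2 : (y - b) + 3 * x * (3 * x * y - 2 * x ^ 3 - c) = 0) :
    gaussianResultant a b c x = 0 := by
  have hy : y * (1 + 9 * x ^ 2) - (b + 6 * x ^ 4 + 3 * c * x) = 0 := by linear_combination h2
  rw [gaussian_resultant_identity a b c x y, h1, hy, mul_zero, mul_zero, add_zero]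

end MomentVariety
end

noncomputable section
namespace MomentVariety
open Polynomial

/-! ### Specialization of the eliminants -/

/-- The coordinates of the data point, as constants. -/
def dataCoord (i : Fin 3) : (MvPolynomial (Fin 3) ℂ)[X] := C (MvPolynomial.X i)

/-- At `(0, 1, 0)` all odd powers of `x` disappear, which keeps the check small; the second
coordinate must not vanish, since the constant term becomes `-9b⁴` and `x = 0` is to be no root. -/
theorem inverseGaussian_generic : ∃ g : MvPolynomial (Fin 3) ℂ, MvPolynomial.eval ![0, 1, 0] g ≠ 0 ∧
    ∀ u, MvPolynomial.eval u g ≠ 0 → ∃ Z : Finset ℂ, Z.card = 12 ∧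
      (∀ x, x ∈ Z ↔ inverseGaussianResultant (u 0) (u 1) (u 2) x = 0) ∧
      ∀ x ∈ Z, inverseGaussianLead (u 0) (u 1) (u 2) x ≠ 0 ∧ x ≠ 0 ∧ 9 * x ^ 2 + 2 ≠ 0 := by
  have hmap : (inverseGaussianResultant (dataCoord 0) (dataCoord 1)
      (dataCoord 2) X).map (MvPolynomial.eval (![0, 1, 0] : Fin 3 → ℂ)) =
      108 * X ^ 12 + 162 * X ^ 10 + (-375) * X ^ 8 + 270 * X ^ 6 + (-164) * X ^ 4 + 72 * X ^ 2
      + (-9) := by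
    simp [inverseGaussianResultant, dataCoord]
    ring
  have hroot : ∀ x : ℂ,
      108 * x ^ 12 + 162 * x ^ 10 + (-375) * x ^ 8 + 270 * x ^ 6 + (-164) * x ^ 4 + 72 * x ^ 2
      + (-9) = 0 →
      (648 * x ^ 10 + 810 * x ^ 8 + (-1500) * x ^ 6 + 810 * x ^ 4 + (-328) * x ^ 2 + 72 : ℂ) ≠
      0 ∧ ((-54) * x ^ 6 + 105 * x ^ 4 + (-89) * x ^ 2 + 18 : ℂ) ≠ 0 ∧ 9 * x ^ 2 + 2 ≠ 0 ∧ x ≠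
      0 := by
    intro x hx
    -- Coprimality by Bézout: extended Euclid writes a nonzero integer as a combination of the
    -- eliminant and each polynomial to be avoided. The first of these is the derivative divided by
    -- `2x`.
    refine ⟨fun h => ?_, fun h => ?_, fun h => ?_, fun h => ?_⟩
    · have h0 : (41174981148672 : ℂ) = 0 := by
        linear_combination ((-14348997295560) * x ^ 8 + (-9467523259362) * x ^ 6 +
        53360258685666 * x ^ 4 + (-17804291495904) * x ^ 2 + 11540827783720) * hx +
        (2391499549260 * x ^ 10 + 2175795430542 * x ^ 8 + (-12014179214073) * x ^ 6 +
        7192088420265 * x ^ 4 + (-4589296814399) * x ^ 2 + 2014478211141) * h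
      norm_num at h0
    · have h0 : (183816880128 : ℂ) = 0 := by
        linear_combination (101876546718 * x ^ 4 + (-168241422975) * x ^ 2 + 119209835474) *
        hx + (203753093436 * x ^ 10 + 365333364774 * x ^ 8 + (-599225468973) * x ^ 6 +
        335989010205 * x ^ 4 + (-215753940587) * x ^ 2 + 69816966633) * h
      norm_num at h0
    · have h0 : (729275 : ℂ) = 0 := by
        linear_combination ((-19683)) * hx + (236196 * x ^ 10 + 301806 * x ^ 8 + (-887193) *
        x ^ 6 + 787644 * x ^ 4 + (-533700) * x ^ 2 + 276064) * h
      norm_num at h0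
    · subst h
      norm_num at hx
  obtain ⟨g, hg, h⟩ := exists_generic_roots (n := 12)
    (inverseGaussianResultant (dataCoord 0) (dataCoord 1) (dataCoord 2) X)
    (inverseGaussianLead (dataCoord 0) (dataCoord 1)
      (dataCoord 2) X * (X * (9 * X ^ 2 + 2)))
    (by unfold inverseGaussianResultant dataCoord; compute_degree) ![0, 1, 0]
    (by rw [← coeff_map, hmap]; simp)
    (fun x hx => by
      rw [hmap] at hx
      rw [Polynomial.map_mul, ← derivative_map, hmap]
      simp [inverseGaussianLead, dataCoord] at hx ⊢
      obtain ⟨hd, hl, h9, h0⟩ := hroot x (by linear_combination hx)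
      refine ⟨fun h => hd ?_, fun h => hl ?_, h0, h9⟩
      · refine mul_left_cancel₀ (mul_ne_zero two_ne_zero h0) ?_
        linear_combination h
      · linear_combination h)
  refine ⟨g, hg, fun u hu => ?_⟩
  obtain ⟨Z, hZ, hr, hq⟩ := h u hu
  refine ⟨Z, hZ, fun x => ?_, fun x hx => ?_⟩
  · rw [hr]
    simp [inverseGaussianResultant, dataCoord]
  · simpa [inverseGaussianLead, dataCoord] using hq x hx

theorem gamma_generic : ∃ g : MvPolynomial (Fin 3) ℂ, MvPolynomial.eval ![0, 1, 0] g ≠ 0 ∧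
    ∀ u, MvPolynomial.eval u g ≠ 0 → ∃ Z : Finset ℂ, Z.card = 10 ∧
      (∀ x, x ∈ Z ↔ gammaResultant (u 0) (u 1) (u 2) x = 0) ∧
      ∀ x ∈ Z, gammaLead (u 0) (u 1) x ≠ 0 ∧ x ≠ 0 := by
  have hmap : (gammaResultant (dataCoord 0) (dataCoord 1)
      (dataCoord 2) X).map (MvPolynomial.eval (![0, 1, 0] : Fin 3 → ℂ)) =
      (-96) * X ^ 10 + (-4) * X ^ 8 + 32 * X ^ 6 + (-2) * X ^ 4 + (-2) * X ^ 2 + 1 := by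
    simp [gammaResultant, dataCoord]
    ring
  have hroot : ∀ x : ℂ,
      (-96) * x ^ 10 + (-4) * x ^ 8 + 32 * x ^ 6 + (-2) * x ^ 4 + (-2) * x ^ 2 + 1 = 0 →
      ((-480) * x ^ 8 + (-16) * x ^ 6 + 96 * x ^ 4 + (-4) * x ^ 2 + (-2) : ℂ) ≠ 0 ∧ (24 * x ^
      6 + 7 * x ^ 4 + (-2) * x ^ 2 + 1 : ℂ) ≠ 0 ∧ x ≠ 0 := by
    intro x hx
    refine ⟨fun h => ?_, fun h => ?_, fun h => ?_⟩
    · have h0 : (17282398 : ℂ) = 0 := by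
        linear_combination ((-610262400) * x ^ 6 + 168024800 * x ^ 4 + 33353056 * x ^ 2 +
        15139920) * hx + (122052480 * x ^ 8 + (-32587856) * x ^ 6 + (-23258220) * x ^ 4 +
        3679086 * x ^ 2 + (-1071239)) * h
      norm_num at h0
    · have h0 : (2401 : ℂ) = 0 := by
        linear_combination (31344 * x ^ 4 + 13870 * x ^ 2 + 495) * hx + (125376 * x ^ 8 +
        24136 * x ^ 6 + (-34092) * x ^ 4 + (-9068) * x ^ 2 + 1906) * h
      norm_num at h0
    · subst h
      norm_num at hx
  obtain ⟨g, hg, h⟩ := exists_generic_roots (n := 10)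
    (gammaResultant (dataCoord 0) (dataCoord 1) (dataCoord 2) X)
    (gammaLead (dataCoord 0) (dataCoord 1) X * X)
    (by unfold gammaResultant dataCoord; compute_degree) ![0, 1, 0]
    (by rw [← coeff_map, hmap]; simp [coeff_one])
    (fun x hx => by
      rw [hmap] at hx
      rw [Polynomial.map_mul, ← derivative_map, hmap]
      simp [gammaLead, dataCoord] at hx ⊢
      obtain ⟨hd, hl, h0⟩ := hroot x (by linear_combination hx)
      refine ⟨fun h => hd ?_, fun h => hl ?_, h0⟩
      · refine mul_left_cancel₀ (mul_ne_zero two_ne_zero h0) ?_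
        linear_combination h
      · linear_combination h)
  refine ⟨g, hg, fun u hu => ?_⟩
  obtain ⟨Z, hZ, hr, hq⟩ := h u hu
  refine ⟨Z, hZ, fun x => ?_, fun x hx => ?_⟩
  · rw [hr]
    simp [gammaResultant, dataCoord]
  · simpa [gammaLead, dataCoord] using hq x hx

theorem gaussian_generic : ∃ g : MvPolynomial (Fin 3) ℂ, MvPolynomial.eval ![0, 1, 0] g ≠ 0 ∧
    ∀ u, MvPolynomial.eval u g ≠ 0 → ∃ Z : Finset ℂ, Z.card = 7 ∧
      (∀ x, x ∈ Z ↔ gaussianResultant (u 0) (u 1) (u 2) x = 0) ∧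
      ∀ x ∈ Z, 1 + 9 * x ^ 2 ≠ 0 := by
  have hmap : (gaussianResultant (dataCoord 0) (dataCoord 1)
      (dataCoord 2) X).map (MvPolynomial.eval (![0, 1, 0] : Fin 3 → ℂ)) =
      72 * X ^ 7 + (-15) * X ^ 5 + (-6) * X ^ 3 + 10 * X ^ 1 := by
    simp [gaussianResultant, dataCoord]
    ring
  have hroot : ∀ x : ℂ,
      72 * x ^ 7 + (-15) * x ^ 5 + (-6) * x ^ 3 + 10 * x = 0 →
      (504 * x ^ 6 + (-75) * x ^ 4 + (-18) * x ^ 2 + 10 : ℂ) ≠ 0 ∧ 1 + 9 * x ^ 2 ≠ 0 := by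
    intro x hx
    refine ⟨fun h => ?_, fun h => ?_⟩
    · have h0 : (23379800 : ℂ) = 0 := by
        linear_combination ((-135939888) * x ^ 5 + 22287990 * x ^ 3 + 5968221 * x ^ 1) * hx
        + (19419984 * x ^ 6 + (-4339950) * x ^ 4 + (-1759857) * x ^ 2 + 2337980) * h
      norm_num at h0
    · have h0 : (841 : ℂ) = 0 := by
        linear_combination ((-729) * x ^ 1) * hx + (5832 * x ^ 6 + (-1863) * x ^ 4 + (-279)
        * x ^ 2 + 841) * h
      norm_num at h0
  obtain ⟨g, hg, h⟩ := exists_generic_roots (n := 7)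
    (gaussianResultant (dataCoord 0) (dataCoord 1) (dataCoord 2) X)
    (1 + 9 * X ^ 2)
    (by unfold gaussianResultant dataCoord; compute_degree) ![0, 1, 0]
    (by rw [← coeff_map, hmap]; simp [coeff_X])
    (fun x hx => by
      rw [hmap] at hx
      rw [Polynomial.map_mul, ← derivative_map, hmap]
      simp at hx ⊢
      obtain ⟨hd, h9⟩ := hroot x (by linear_combination hx)
      refine ⟨fun h => hd ?_, h9⟩
      linear_combination h)
  refine ⟨g, hg, fun u hu => ?_⟩
  obtain ⟨Z, hZ, hr, hq⟩ := h u hu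
  refine ⟨Z, hZ, fun x => ?_, fun x hx => ?_⟩
  · rw [hr]
    simp [gaussianResultant, dataCoord]
  · simpa using hq x hx

end MomentVariety
end

noncomputable section
namespace MomentVariety
open MvPolynomial

/-! ### The Euclidean distance degrees -/

theorem hasEDDegree_inverseGaussian : HasEDDegree (affinePatch (inverseGaussianVariety 3)) 12 := by
  rw [affinePatch_inverseGaussianVariety]
  obtain ⟨g, hg, h⟩ := inverseGaussian_generic
  refine ⟨g * X 1, fun h0 => ?_, fun u hu => ?_⟩
  · have := congrArg (eval ![0, 1, 0]) h0
    simp [hg] at this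
  · rw [map_mul, eval_X, mul_ne_zero_iff] at hu
    obtain ⟨Z, hZ, hr, hq⟩ := h u hu.1
    let s : ℂ → ℂ := fun x => -inverseGaussianConst (u 0) (u 1) (u 2) x /
      inverseGaussianLead (u 0) (u 1) (u 2) x
    have hcrit : criticalPoints (quarticSurface 3 (-3) 1) u =
        (fun x => ![x, s x * x, 3 * s x ^ 2 * x + -3 * s x * x ^ 2 + 1 * x ^ 3]) '' Z := by
      ext v
      rw [mem_criticalPoints_quartic_iff three_ne_zero _ _ hu.2]
      constructor
      · rintro ⟨x, t, hx, rfl, hB, hA⟩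
        -- Membership in `Z` has to come first: the nonvanishing of the divisors is known only at
        -- roots of the eliminant.
        have hxZ := (hr x).mpr (inverseGaussian_resultant_eq_zero hx hB hA)
        obtain ⟨hL, -, h2⟩ := hq x hxZ
        have ht : t = s x := ((inverseGaussian_elim hx hL h2).mp ⟨hB, hA⟩).2
        exact ⟨x, hxZ, by rw [ht]⟩
      · rintro ⟨x, hxZ, rfl⟩
        obtain ⟨hL, hx, h2⟩ := hq x hxZ
        exact ⟨x, s x, hx, rfl, (inverseGaussian_elim hx hL h2).mpr ⟨(hr x).mp hxZ, rfl⟩⟩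
    rw [hcrit, Set.InjOn.encard_image (fun x _ y _ hxy => by simpa using congrFun hxy 0),
      Set.encard_coe_eq_coe_finsetCard, hZ]

theorem hasEDDegree_gamma : HasEDDegree (affinePatch (gammaVariety 3)) 10 := by
  rw [affinePatch_gammaVariety]
  obtain ⟨g, hg, h⟩ := gamma_generic
  -- With `u = (a, b, c)`: `b ≠ 0` excludes the line `x = y = 0`. A solution with `s = 0` has `x =
  -- a` and forces `b = ac`. A root `s` with `x = 0` would be a double root of `2cs² + bs + a`,
  -- forcing `b² = 8ac`.
  refine ⟨g * (X 1 * ((X 1 - X 0 * X 2) * (X 1 ^ 2 - C 8 * X 0 * X 2))), fun h0 => ?_, fun u hu => ?_⟩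
  · have := congrArg (eval ![0, 1, 0]) h0
    simp [hg] at this
  · simp only [map_mul, map_sub, map_pow, eval_X, eval_C, mul_ne_zero_iff] at hu
    obtain ⟨hg', hb, hac, hbac⟩ := hu
    obtain ⟨Z, hZ, hr, hq⟩ := h u hg'
    let x : ℂ → ℂ := fun s => -gammaConst (u 0) (u 1) (u 2) s / gammaLead (u 0) (u 1) s
    have hx : ∀ s ∈ Z, gammaLead (u 0) (u 1) s * x s + gammaConst (u 0) (u 1) (u 2) s = 0 := by
      intro s hs
      have hL := (hq s hs).1
      simp only [x]
      field_simp
      ring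
    have hx0 : ∀ s ∈ Z, x s ≠ 0 := by
      intro s hs h0
      obtain ⟨hL, hs0⟩ := hq s hs
      obtain ⟨hB, hA⟩ := gamma_critical_of_linear hs0 hL ((hr s).mp hs) (hx s hs)
      rw [h0] at hA hB
      refine hbac ?_
      linear_combination 8 * u 2 * hB - (u 1 + 4 * s * u 2) * hA
    have hcrit : criticalPoints (quarticSurface 2 (-1) 0) u =
        (fun s => ![x s, s * x s, 2 * s ^ 2 * x s + -1 * s * x s ^ 2 + 0 * x s ^ 3]) '' Z := by
      ext v
      rw [mem_criticalPoints_quartic_iff two_ne_zero _ _ hb]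
      constructor
      · rintro ⟨y, s, hy, rfl, hB, hA⟩
        have hs : s ≠ 0 := by
          rintro rfl
          refine hac ?_
          linear_combination (u 2) * hB - hA
        obtain ⟨hR, hlin⟩ := gamma_consequences hs hB hA
        have hsZ := (hr s).mpr hR
        have hyx : y = x s :=
          mul_left_cancel₀ (hq s hsZ).1 (by linear_combination hlin - hx s hsZ)
        exact ⟨s, hsZ, by rw [hyx]⟩
      · rintro ⟨s, hs, rfl⟩
        obtain ⟨hL, hs0⟩ := hq s hs
        exact ⟨x s, s, hx0 s hs, rfl,
          gamma_critical_of_linear hs0 hL ((hr s).mp hs) (hx s hs)⟩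
    rw [hcrit, Set.InjOn.encard_image, Set.encard_coe_eq_coe_finsetCard, hZ]
    -- The root is recovered from the point as `s = y / x`, since `x ≠ 0`.
    intro s hs t ht hst
    have h0 : x s = x t := by simpa using congrFun hst 0
    have h1 : s * x s = t * x t := by simpa using congrFun hst 1
    rw [← h0] at h1
    exact mul_right_cancel₀ (hx0 s hs) h1

theorem hasEDDegree_gaussian : HasEDDegree (affinePatch (gaussianVariety 3)) 7 := by
  obtain ⟨g, hg, h⟩ := gaussian_generic
  refine ⟨g, fun h0 => hg (by rw [h0, map_zero]), fun u hu => ?_⟩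
  obtain ⟨Z, hZ, hr, hq⟩ := h u hu
  let y : ℂ → ℂ := fun x => (u 1 + 6 * x ^ 4 + 3 * u 2 * x) / (1 + 9 * x ^ 2)
  have hcrit : criticalPoints (affinePatch (gaussianVariety 3)) u =
      (fun x => ![x, y x, 3 * x * y x - 2 * x ^ 3]) '' Z := by
    ext v
    rw [mem_criticalPoints_gaussian_iff]
    constructor
    · rintro ⟨x, t, rfl, h1, h2⟩
      have hxZ := (hr x).mpr (gaussian_resultant_eq_zero h1 h2)
      have ht : t = y x := ((gaussian_elim (hq x hxZ)).mp ⟨h1, h2⟩).2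
      exact ⟨x, hxZ, by rw [ht]⟩
    · rintro ⟨x, hxZ, rfl⟩
      exact ⟨x, y x, rfl, (gaussian_elim (hq x hxZ)).mpr ⟨(hr x).mp hxZ, rfl⟩⟩
  rw [hcrit, Set.InjOn.encard_image (fun x _ y _ hxy => by simpa using congrFun hxy 0),
    Set.encard_coe_eq_coe_finsetCard, hZ]

end MomentVariety
end

theorem mainTheorem12 :
    MomentVariety.HasEDDegree
        (MomentVariety.affinePatch (MomentVariety.inverseGaussianVariety 3)) 12 ∧
      MomentVariety.HasEDDegree
        (MomentVariety.affinePatch (MomentVariety.gammaVariety 3)) 10 ∧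
      MomentVariety.HasEDDegree
        (MomentVariety.affinePatch (MomentVariety.gaussianVariety 3)) 7 :=
  ⟨MomentVariety.hasEDDegree_inverseGaussian, MomentVariety.hasEDDegree_gamma,
    MomentVariety.hasEDDegree_gaussian⟩
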